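/- Let $\&$ be a continuous triangular norm on $[0,1]$, that is, a continuous, commutative, associative binary operation that is monotone in each argument and satisfies $x\,\&\,1=x$. Call $K\subseteq[0,1]$ a complete subquantale of $([0,1],\&,1)$ if it is closed under arbitrary (including empty) joins and meets and under $\&$; then $M=\{a\in[0,1]\mid (a\,\&\,a)\,\&\,(a\,\&\,a)=a\,\&\,a\}$ is a complete subquantale of $([0,1],\&,1)$. Let $(K,\&,1)$ be a complete subquantale of $([0,1],\&,1)$ with $K\subseteq M$, that is, a complete subquantale of $(M,\&,1)$. A $[0,1]$-category is a set $X$ with a map $r:X\times X\to[0,1]$ such that $r(x,x)=1$ and $r(y,z)\,\&\,r(x,y)\le r(x,z)$ for all $x,y,z\in X$; it is a $K$-category if $r$ takes values in $K$, and symmetric if $r(x,y)=r(y,x)$ for all $x,y\in X$. A $[0,1]$-functor $f:(X,r)\to(Y,s)$ is a map with $r(x_1,x_2)\le s(f(x_1),f(x_2))$ for all $x_1,x_2\in X$. A net $(x_\lambda)_{\lambda\in D}$ in $(X,r)$, indexed by a nonempty directed preordered set $D$, is forward Cauchy if $\bigvee_{\lambda\in D}\bigwedge_{\lambda\le\mu\le\gamma}r(x_\mu,x_\gamma)=1$,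 and $a\in X$ is a Yoneda limit of it if $r(a,x)=\bigvee_{\lambda\in D}\bigwedge_{\lambda\le\mu}r(x_\mu,x)$ for all $x\in X$. The $[0,1]$-category $(X,r)$ is Yoneda complete if every forward Cauchy net in it has a Yoneda limit, and a $[0,1]$-functor $f$ is Yoneda continuous if for each forward Cauchy net $(x_\lambda)_{\lambda\in D}$ and each Yoneda limit $a$ of it, $f(a)$ is a Yoneda limit of $(f(x_\lambda))_{\lambda\in D}$. Then: 1. The category $K\text{-}\mathbf{YCCat}$ of Yoneda complete $K$-categories and Yoneda continuous $[0,1]$-functors is cartesian closed. 2. The full subcategory of $K\text{-}\mathbf{YCCat}$ consisting of the symmetric Yoneda complete $K$-categories is cartesian closed. -/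

import Mathlib

open CategoryTheory

universe u

/-- A continuous triangular norm on the unit interval `[0,1]`. -/
structure ContinuousTNorm where
  /-- The binary operation `x & y`. -/
  op : unitInterval → unitInterval → unitInterval
  comm : ∀ x y, op x y = op y x
  assoc : ∀ x y z, op x (op y z) = op (op x y) z
  mono : ∀ x y z, y ≤ z → op x y ≤ op x z
  op_one : ∀ x, op x 1 = x
  continuous : Continuous fun p : unitInterval × unitInterval => op p.1 p.2

namespace ContinuousTNorm

/-- A complete subquantale of `([0,1], &, 1)`: a subset of `[0,1]` closed under arbitrary joins
and meets (in particular under the empty ones, so that it contains `0` and `1`) and under `&`. -/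
structure CompleteSubquantale (T : ContinuousTNorm) extends CompleteSublattice unitInterval where
  op_mem : ∀ a ∈ carrier, ∀ b ∈ carrier, T.op a b ∈ carrier

variable (T : ContinuousTNorm)

/-- `a` is an idempotent element of `&`. -/
def IsIdem (a : unitInterval) : Prop := T.op a a = a

theorem mono₂ {a b c d : unitInterval} (h : a ≤ b) (h' : c ≤ d) : T.op a c ≤ T.op b d := by
  refine (T.mono a c d h').trans ?_
  rw [T.comm a d, T.comm b d]
  exact T.mono d a b h

theorem op_op_op_comm (a b : unitInterval) :
    T.op (T.op a b) (T.op a b) = T.op (T.op a a) (T.op b b) := by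
  rw [T.assoc, ← T.assoc a b a, T.comm b a, T.assoc a a b, ← T.assoc (T.op a a) b b]

theorem continuous_sq : Continuous fun a => T.op a a :=
  T.continuous.comp (continuous_id.prodMk continuous_id)

theorem sq_sSup (S : Set unitInterval) :
    T.op (sSup S) (sSup S) = sSup ((fun a => T.op a a) '' S) :=
  Monotone.map_sSup_of_continuousAt (f := fun a => T.op a a) T.continuous_sq.continuousAt
    (fun _ _ h => T.mono₂ h h) (le_bot_iff.1 ((T.mono ⊥ ⊥ 1 bot_le).trans (T.op_one ⊥).le))

theorem sq_sInf (S : Set unitInterval) :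
    T.op (sInf S) (sInf S) = sInf ((fun a => T.op a a) '' S) :=
  Monotone.map_sInf_of_continuousAt (f := fun a => T.op a a) T.continuous_sq.continuousAt
    (fun _ _ h => T.mono₂ h h) (T.op_one 1)

/-- The complete subquantale `M = {a ∈ [0,1] | a & a is idempotent}` of `([0,1], &, 1)`. -/
noncomputable def M : T.CompleteSubquantale where
  toCompleteSublattice := CompleteSublattice.mk' {a | T.IsIdem (T.op a a)}
    (by
      intro S hS
      have h : (fun a => T.op a a) '' ((fun a => T.op a a) '' S) = (fun a => T.op a a) '' S := by
        rw [Set.image_image]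
        exact Set.image_congr fun a ha => hS ha
      change T.op (T.op (sSup S) (sSup S)) (T.op (sSup S) (sSup S)) = T.op (sSup S) (sSup S)
      rw [T.sq_sSup S, T.sq_sSup, h])
    (by
      intro S hS
      have h : (fun a => T.op a a) '' ((fun a => T.op a a) '' S) = (fun a => T.op a a) '' S := by
        rw [Set.image_image]
        exact Set.image_congr fun a ha => hS ha
      change T.op (T.op (sInf S) (sInf S)) (T.op (sInf S) (sInf S)) = T.op (sInf S) (sInf S)
      rw [T.sq_sInf S, T.sq_sInf, h])
  op_mem := by
    intro a ha b hb
    change T.op (T.op a a) (T.op a a) = T.op a a at ha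
    change T.op (T.op b b) (T.op b b) = T.op b b at hb
    change T.op (T.op (T.op a b) (T.op a b)) (T.op (T.op a b) (T.op a b))
      = T.op (T.op a b) (T.op a b)
    rw [T.op_op_op_comm a b, T.op_op_op_comm, ha, hb]

end ContinuousTNorm

/-- A real-enriched category, or `[0,1]`-category, `(X, r)` with respect to a continuous t-norm. -/
structure RealCat (T : ContinuousTNorm) : Type (u + 1) where
  /-- The underlying set. -/
  carrier : Type u
  /-- The structure map. -/
  r : carrier → carrier → unitInterval
  r_self : ∀ x, r x x = 1
  r_comp : ∀ x y z, T.op (r y z) (r x y) ≤ r x z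

namespace RealCat

variable {T : ContinuousTNorm}

/-- `[0,1]`-functors. -/
def IsFunctor {X Y : RealCat.{u} T} (f : X.carrier → Y.carrier) : Prop :=
  ∀ x₁ x₂, X.r x₁ x₂ ≤ Y.r (f x₁) (f x₂)

/-- The net `x` indexed by `D` is forward Cauchy. -/
def IsForwardCauchy (X : RealCat.{u} T) {D : Type u} [Preorder D] (x : D → X.carrier) : Prop :=
  (⨆ l : D, ⨅ m : D, ⨅ g : D, ⨅ (_ : l ≤ m) (_ : m ≤ g), X.r (x m) (x g)) = 1

/-- `a` is a Yoneda limit of the net `x`. -/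
def IsYonedaLimit (X : RealCat.{u} T) {D : Type u} [Preorder D] (x : D → X.carrier)
    (a : X.carrier) : Prop :=
  ∀ y, X.r a y = ⨆ l : D, ⨅ m : D, ⨅ _ : l ≤ m, X.r (x m) y

/-- Every forward Cauchy net has a Yoneda limit. Nets are indexed by nonempty directed
preordered sets. -/
def IsYonedaComplete (X : RealCat.{u} T) : Prop :=
  ∀ (D : Type u) [Preorder D] [IsDirectedOrder D] [Nonempty D] (x : D → X.carrier),
    X.IsForwardCauchy x → ∃ a, X.IsYonedaLimit x a

/-- The map `f` sends every Yoneda limit of every forward Cauchy net to a Yoneda limit of the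
image net (Yoneda limits are unique only up to isomorphism). -/
def IsYonedaContinuous {X Y : RealCat.{u} T} (f : X.carrier → Y.carrier) : Prop :=
  ∀ (D : Type u) [Preorder D] [IsDirectedOrder D] [Nonempty D] (x : D → X.carrier)
    (a : X.carrier), X.IsForwardCauchy x → X.IsYonedaLimit x a →
      Y.IsYonedaLimit (fun l => f (x l)) (f a)

/-- All values of the structure map lie in `K`. -/
def IsKCategory (K : T.CompleteSubquantale) (X : RealCat.{u} T) : Prop :=
  ∀ x y, X.r x y ∈ K.carrier

/-- Symmetric `[0,1]`-categories. -/
def IsSymmetric (X : RealCat.{u} T) : Prop := ∀ x y, X.r x y = X.r y x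

theorem IsFunctor.isForwardCauchy {X Y : RealCat.{u} T} {f : X.carrier → Y.carrier}
    (hf : IsFunctor f) {D : Type u} [Preorder D] {x : D → X.carrier}
    (hx : X.IsForwardCauchy x) : Y.IsForwardCauchy fun l => f (x l) := by
  refine le_antisymm unitInterval.le_one' ?_
  rw [← show _ = (1 : unitInterval) from hx]
  exact iSup_mono fun l => iInf_mono fun m => iInf_mono fun g =>
    iInf_mono fun _ => iInf_mono fun _ => hf _ _

end RealCat

/-- Yoneda complete `[0,1]`-categories. -/
structure YCCat (T : ContinuousTNorm) : Type (u + 1) extends RealCat.{u} T where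
  complete : toRealCat.IsYonedaComplete

namespace YCCat

variable {T : ContinuousTNorm}

/-- Yoneda continuous `[0,1]`-functors. -/
@[ext]
structure Hom (X Y : YCCat.{u} T) : Type u where
  /-- The underlying map. -/
  toFun : X.carrier → Y.carrier
  isFunctor : RealCat.IsFunctor (X := X.toRealCat) (Y := Y.toRealCat) toFun
  isYonedaContinuous : RealCat.IsYonedaContinuous (X := X.toRealCat) (Y := Y.toRealCat) toFun

/-- The category of Yoneda complete `[0,1]`-categories and Yoneda continuous `[0,1]`-functors. -/
instance : Category.{u} (YCCat.{u} T) where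
  Hom X Y := Hom X Y
  id X := ⟨fun x => x, fun _ _ => le_rfl, fun _ _ _ _ _ _ _ ha => ha⟩
  comp f g := ⟨fun x => g.toFun (f.toFun x),
    fun _ _ => (f.isFunctor _ _).trans (g.isFunctor _ _),
    fun D _ _ _ x a hx ha => g.isYonedaContinuous D _ _ (f.isFunctor.isForwardCauchy hx)
      (f.isYonedaContinuous D x a hx ha)⟩

/-- The objects of `K-YCCat` among those of `YCCat`. -/
def isKCategory (K : T.CompleteSubquantale) : ObjectProperty (YCCat.{u} T) :=
  fun X => X.toRealCat.IsKCategory K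

end YCCat

/-- `K-YCCat`: Yoneda complete `K`-categories and Yoneda continuous `[0,1]`-functors. -/
abbrev KYCCat {T : ContinuousTNorm} (K : T.CompleteSubquantale) : Type (u + 1) :=
  (YCCat.isKCategory.{u} K).FullSubcategory

/-- The symmetric objects of `K-YCCat`. -/
def KYCCat.isSymmetric {T : ContinuousTNorm} (K : T.CompleteSubquantale) :
    ObjectProperty (KYCCat.{u} K) :=
  fun X => X.obj.toRealCat.IsSymmetric

/-- The full subcategory of `K-YCCat` on the symmetric `K`-categories. -/
abbrev SymKYCCat {T : ContinuousTNorm} (K : T.CompleteSubquantale) : Type (u + 1) :=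
  (KYCCat.isSymmetric.{u} K).FullSubcategory

/-- A category is cartesian closed if it has finite products and for each object `X` the functor
`X × -` has a right adjoint. -/
def IsCartesianClosed (C : Type (u + 1)) [Category.{u} C] : Prop :=
  ∃ _ : CartesianMonoidalCategory C, Nonempty (MonoidalClosed C)

/-! The exponential of `X` and `Y` is the set of Yoneda continuous functors with `r f g = ⨅ x x',
X.r x x' ⇨ Y.r (f x) (g x')`, where `⇨` is adjoint to `⊓`, not to `&`. Composition must therefore
pass `⊓` through `&`. The inequality `inf_op_le` does this, and it is the one place where the values
must lie in `M`.

Completeness comes from pointwise limits: a forward Cauchy net of functors approaches its pointwise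
limit uniformly (`exists_forall_inf_le`), so the limit is again Yoneda continuous. Evaluation is
continuous by a diagonal argument. On the chain `[0,1]` the value `a ⇨ b` is `1` or `b`, so
exponentials stay inside `K`; symmetry is inherited too. Both subcategories are then closed under
the constructions made in `YCCat`. -/

namespace ContinuousTNorm

variable (T : ContinuousTNorm)

theorem op_le_left (a b : unitInterval) : T.op a b ≤ a :=
  (T.mono a b 1 unitInterval.le_one').trans (T.op_one a).le

/-- By continuity at `1`, an inequality may be tested after multiplying by all `q < 1`. -/
theorem le_of_forall_op_le {c b : unitInterval} (h : ∀ q < 1, T.op c q ≤ b) : c ≤ b := by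
  have hc : Continuous fun q => T.op c q := T.continuous.comp (Continuous.prodMk_right c)
  have ht : Filter.Tendsto (fun q => T.op c q) (nhdsWithin 1 (Set.Iio 1)) (nhds c) := by
    have := (hc.tendsto 1).mono_left (nhdsWithin_le_nhds (s := Set.Iio 1))
    rwa [T.op_one] at this
  have : (nhdsWithin (1 : unitInterval) (Set.Iio 1)).NeBot :=
    nhdsLT_neBot_of_exists_lt ⟨0, zero_lt_one⟩
  exact le_of_tendsto ht (Filter.eventually_of_mem self_mem_nhdsWithin h)

/-- Elements below an idempotent absorb it. -/
theorem op_eq_of_le_idem {w e : unitInterval} (he : T.IsIdem e) (hw : w ≤ e) : T.op w e = w := by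
  have hc : Continuous fun q => T.op e q := T.continuous.comp (Continuous.prodMk_right e)
  have h0 : T.op e 0 = 0 := by
    rw [T.comm]
    exact le_antisymm (T.op_le_left 0 e) unitInterval.nonneg'
  -- `q ↦ e & q` runs continuously from `0` to `e`, so `w = e & t` for some `t`.
  obtain ⟨t, -, ht⟩ := intermediate_value_Icc (unitInterval.nonneg' (t := 1)) hc.continuousOn
    (show w ∈ Set.Icc (T.op e 0) (T.op e 1) from
      ⟨h0.le.trans unitInterval.nonneg', (T.op_one e).symm ▸ hw⟩)
  change T.op e t = w at ht
  rw [← ht, T.comm, T.assoc, show T.op e e = e from he]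

/-- The interchange inequality that makes the category of `M`-categories cartesian closed. -/
theorem inf_op_le {u v : unitInterval} (a : unitInterval) (hu : T.IsIdem (T.op u u))
    (hv : T.IsIdem (T.op v v)) :
    a ⊓ T.op u v ≤ T.op u (a ⊓ v) ⊔ T.op (a ⊓ u) v := by
  wlog h : u ≤ v generalizing u v
  · have := this hv hu (le_of_not_ge h)
    rw [T.comm v u, T.comm v, T.comm _ u] at this
    rwa [sup_comm]
  have hvv : T.op v v ≤ v := T.op_le_left v v
  -- The idempotent `v & v` absorbs whatever lies below it: `a ⊓ u` in the first case, `a ⊓ (v & v)`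
  -- in the second.
  rcases le_total u (T.op v v) with hue | hue
  · refine le_sup_of_le_right ?_
    calc a ⊓ T.op u v ≤ a ⊓ u := inf_le_inf_left a (T.op_le_left u v)
      _ = T.op (a ⊓ u) (T.op v v) := (T.op_eq_of_le_idem hv (inf_le_right.trans hue)).symm
      _ ≤ _ := T.mono _ _ _ hvv
  · refine le_sup_of_le_left ?_
    have huv : T.op u v ≤ T.op v v := T.mono₂ h le_rfl
    calc a ⊓ T.op u v ≤ a ⊓ T.op v v := inf_le_inf_left a huv
      _ = T.op (a ⊓ T.op v v) (T.op v v) := (T.op_eq_of_le_idem hv inf_le_right).symm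
      _ = T.op (T.op v v) (a ⊓ T.op v v) := T.comm _ _
      _ ≤ _ := T.mono₂ hue (inf_le_inf_left a hvv)

end ContinuousTNorm

theorem unitInterval.eq_one_of_forall_lt {a : unitInterval} (h : ∀ q < 1, q ≤ a) : a = 1 :=
  le_antisymm unitInterval.le_one' (le_of_forall_lt_imp_le_of_dense h)

namespace ContinuousTNorm.CompleteSubquantale

variable {T : ContinuousTNorm} (K : T.CompleteSubquantale)

theorem one_mem : (1 : unitInterval) ∈ K.carrier := by
  have := K.sInfClosed' (Set.empty_subset K.carrier)
  rwa [sInf_empty] at this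

theorem iInf_mem {ι : Sort*} {f : ι → unitInterval} (h : ∀ i, f i ∈ K.carrier) :
    (⨅ i, f i) ∈ K.carrier :=
  K.sInfClosed' (by rintro _ ⟨i, rfl⟩; exact h i)

theorem inf_mem {a b : unitInterval} (ha : a ∈ K.carrier) (hb : b ∈ K.carrier) :
    a ⊓ b ∈ K.carrier := by
  rcases le_total a b with h | h
  · rwa [inf_eq_left.2 h]
  · rwa [inf_eq_right.2 h]

/-- On a chain, `a ⇨ b` is `1` or `b`. Since `a` is arbitrary, only the codomain of a function space
has to be a `K`-category. -/
theorem himp_mem (a : unitInterval) {b : unitInterval} (hb : b ∈ K.carrier) :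
    (a ⇨ b) ∈ K.carrier := by
  rcases le_or_gt a b with h | h
  · rw [himp_eq_top_iff.2 h]
    exact K.one_mem
  · have : (a ⇨ b) = b := eq_of_forall_le_iff fun c => by
      rw [le_himp_iff, inf_le_iff, or_iff_left (not_le.2 h)]
    rwa [this]

end ContinuousTNorm.CompleteSubquantale

/-! ### Yoneda limits by approximation, and finite products -/

namespace RealCat

variable {T : ContinuousTNorm} {X Y : RealCat.{u} T}

theorem op_r_le {c d : unitInterval} {x y z : X.carrier} (h : c ≤ X.r x y) (h' : d ≤ X.r y z) :
    T.op c d ≤ X.r x z :=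
  (T.mono₂ h h').trans ((T.comm _ _).le.trans (X.r_comp x y z))

section

variable {D : Type u} [Preorder D]

theorem isForwardCauchy_iff {x : D → X.carrier} :
    X.IsForwardCauchy x ↔ ∀ q < 1, ∃ l, ∀ m g, l ≤ m → m ≤ g → q ≤ X.r (x m) (x g) := by
  constructor
  · intro h q hq
    rw [IsForwardCauchy] at h
    rw [← h, lt_iSup_iff] at hq
    obtain ⟨l, hl⟩ := hq
    refine ⟨l, fun m g hm hg => hl.le.trans ?_⟩
    exact (iInf_le _ m).trans ((iInf_le _ g).trans ((iInf_le _ hm).trans (iInf_le _ hg)))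
  · intro h
    refine unitInterval.eq_one_of_forall_lt fun q hq => ?_
    obtain ⟨l, hl⟩ := h q hq
    exact le_iSup_of_le l (le_iInf fun m => le_iInf fun g => le_iInf fun hm => le_iInf fun hg =>
      hl m g hm hg)

/-- Continuity of `&` at `1` trades the join formula for two estimates: the net eventually comes
within any `q < 1` of `a`, and eventual lower bounds pass to `a`. -/
theorem isYonedaLimit_iff {x : D → X.carrier} {a : X.carrier} :
    X.IsYonedaLimit x a ↔ (∀ q < 1, ∃ l, ∀ m, l ≤ m → q ≤ X.r (x m) a) ∧
      ∀ y c l, (∀ m, l ≤ m → c ≤ X.r (x m) y) → c ≤ X.r a y := by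
  constructor
  · refine fun h => ⟨fun q hq => ?_, fun y c l hl => ?_⟩
    · rw [← X.r_self a, h a, lt_iSup_iff] at hq
      obtain ⟨l, hl⟩ := hq
      exact ⟨l, fun m hm => hl.le.trans ((iInf_le _ m).trans (iInf_le _ hm))⟩
    · rw [h y]
      exact le_iSup_of_le l (le_iInf fun m => le_iInf fun hm => hl m hm)
  · rintro ⟨h₁, h₂⟩ y
    refine le_antisymm (T.le_of_forall_op_le fun q hq => ?_) (iSup_le fun l => ?_)
    · obtain ⟨l, hl⟩ := h₁ q hq
      rw [T.comm]
      exact le_iSup_of_le l (le_iInf fun m => le_iInf fun hm => op_r_le (hl m hm) le_rfl)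
    · exact h₂ y _ l fun m hm => (iInf_le _ m).trans (iInf_le _ hm)

theorem IsYonedaLimit.r_eq_one {x : D → X.carrier} {a b : X.carrier} (ha : X.IsYonedaLimit x a)
    (hb : X.IsYonedaLimit x b) : X.r a b = 1 := by
  refine unitInterval.eq_one_of_forall_lt fun q hq => ?_
  obtain ⟨l, hl⟩ := (isYonedaLimit_iff.1 hb).1 q hq
  exact (isYonedaLimit_iff.1 ha).2 b q l hl

theorem IsYonedaLimit.of_r_eq_one {x : D → X.carrier} {a b : X.carrier}
    (ha : X.IsYonedaLimit x a) (hab : X.r a b = 1) (hba : X.r b a = 1) :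
    X.IsYonedaLimit x b := by
  refine fun y => (le_antisymm ?_ ?_ : X.r b y = X.r a y).trans (ha y)
  · have := X.r_comp a b y
    rwa [hab, T.op_one] at this
  · have := X.r_comp b a y
    rwa [hba, T.op_one] at this

theorem isYonedaLimit_const [Nonempty D] (a : X.carrier) :
    X.IsYonedaLimit (fun _ : D => a) a := by
  refine isYonedaLimit_iff.2 ⟨fun q _ => ?_, fun y c l h => h l le_rfl⟩
  obtain ⟨l⟩ := ‹Nonempty D›
  exact ⟨l, fun _ _ => (X.r_self a).symm ▸ unitInterval.le_one'⟩

theorem isForwardCauchy_const [Nonempty D] (a : X.carrier) :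
    X.IsForwardCauchy (fun _ : D => a) := by
  refine isForwardCauchy_iff.2 fun q _ => ?_
  obtain ⟨l⟩ := ‹Nonempty D›
  exact ⟨l, fun _ _ _ _ => (X.r_self a).symm ▸ unitInterval.le_one'⟩

end

/-- A functor preserves a Yoneda limit as soon as the colimit-type inequality holds. -/
theorem IsFunctor.isYonedaContinuous {f : X.carrier → Y.carrier}
    (hf : IsFunctor (X := X) (Y := Y) f)
    (h : ∀ (D : Type u) [Preorder D] [IsDirectedOrder D] [Nonempty D] (x : D → X.carrier)
      (a : X.carrier), X.IsForwardCauchy x → X.IsYonedaLimit x a → ∀ y c l,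
        (∀ m, l ≤ m → c ≤ Y.r (f (x m)) y) → c ≤ Y.r (f a) y) :
    IsYonedaContinuous (X := X) (Y := Y) f := by
  intro D _ _ _ x a hx ha
  refine isYonedaLimit_iff.2 ⟨fun q hq => ?_, h D x a hx ha⟩
  obtain ⟨l, hl⟩ := (isYonedaLimit_iff.1 ha).1 q hq
  exact ⟨l, fun m hm => (hl m hm).trans (hf _ _)⟩

/-- The one-point category. -/
def unit (T : ContinuousTNorm) : RealCat.{u} T where
  carrier := PUnit
  r _ _ := 1
  r_self _ := rfl
  r_comp _ _ _ := unitInterval.le_one'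

/-- The product of two `[0,1]`-categories. -/
def prod (X Y : RealCat.{u} T) : RealCat.{u} T where
  carrier := X.carrier × Y.carrier
  r p q := X.r p.1 q.1 ⊓ Y.r p.2 q.2
  r_self p := by rw [X.r_self, Y.r_self, inf_idem]
  r_comp p q s := le_inf ((T.mono₂ inf_le_left inf_le_left).trans (X.r_comp _ _ _))
    ((T.mono₂ inf_le_right inf_le_right).trans (Y.r_comp _ _ _))

theorem isFunctor_fst : IsFunctor (X := X.prod Y) (Y := X) Prod.fst := fun _ _ => inf_le_left

theorem isFunctor_snd : IsFunctor (X := X.prod Y) (Y := Y) Prod.snd := fun _ _ => inf_le_right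

section

variable {D : Type u} [Preorder D] [IsDirectedOrder D]

theorem isForwardCauchy_prod {x : D → X.carrier} {y : D → Y.carrier} (hx : X.IsForwardCauchy x)
    (hy : Y.IsForwardCauchy y) : (X.prod Y).IsForwardCauchy fun l => (x l, y l) := by
  refine isForwardCauchy_iff.2 fun q hq => ?_
  obtain ⟨l, hl⟩ := isForwardCauchy_iff.1 hx q hq
  obtain ⟨l', hl'⟩ := isForwardCauchy_iff.1 hy q hq
  obtain ⟨k, hk, hk'⟩ := exists_ge_ge l l'
  exact ⟨k, fun m g hm hg => le_inf (hl m g (hk.trans hm) hg) (hl' m g (hk'.trans hm) hg)⟩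

theorem isYonedaLimit_prod {x : D → X.carrier} {y : D → Y.carrier} {a : X.carrier}
    {b : Y.carrier} (ha : X.IsYonedaLimit x a) (hb : Y.IsYonedaLimit y b) :
    (X.prod Y).IsYonedaLimit (fun l => (x l, y l)) (a, b) := by
  rw [isYonedaLimit_iff] at ha hb
  refine isYonedaLimit_iff.2 ⟨fun q hq => ?_, fun z c l h => ?_⟩
  · obtain ⟨l, hl⟩ := ha.1 q hq
    obtain ⟨l', hl'⟩ := hb.1 q hq
    obtain ⟨k, hk, hk'⟩ := exists_ge_ge l l'
    exact ⟨k, fun m hm => le_inf (hl m (hk.trans hm)) (hl' m (hk'.trans hm))⟩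
  · exact le_inf (ha.2 _ _ l fun m hm => (h m hm).trans inf_le_left)
      (hb.2 _ _ l fun m hm => (h m hm).trans inf_le_right)

theorem isYonedaContinuous_fst : IsYonedaContinuous (X := X.prod Y) (Y := X) Prod.fst := by
  refine isFunctor_fst.isYonedaContinuous fun D _ _ _ x a _ ha y c l h => ?_
  rw [isYonedaLimit_iff] at ha
  refine T.le_of_forall_op_le fun q hq => ?_
  obtain ⟨k, hk⟩ := ha.1 q hq
  obtain ⟨n, hn, hn'⟩ := exists_ge_ge l k
  -- The test point keeps the second coordinate at `a.2`, where the net is only eventually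
  -- `q`-close; hence the bound `c & q`, with `q` tending to `1`.
  refine (ha.2 (y, a.2) (T.op c q) n fun m hm => le_inf ?_ ?_).trans inf_le_left
  · exact (T.op_le_left _ _).trans (h m (hn.trans hm))
  · rw [T.comm]
    exact (T.op_le_left _ _).trans ((hk m (hn'.trans hm)).trans inf_le_right)

theorem isYonedaContinuous_snd : IsYonedaContinuous (X := X.prod Y) (Y := Y) Prod.snd := by
  refine isFunctor_snd.isYonedaContinuous fun D _ _ _ x a _ ha y c l h => ?_
  rw [isYonedaLimit_iff] at ha
  refine T.le_of_forall_op_le fun q hq => ?_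
  obtain ⟨k, hk⟩ := ha.1 q hq
  obtain ⟨n, hn, hn'⟩ := exists_ge_ge l k
  refine (ha.2 (a.1, y) (T.op c q) n fun m hm => le_inf ?_ ?_).trans inf_le_right
  · rw [T.comm]
    exact (T.op_le_left _ _).trans ((hk m (hn'.trans hm)).trans inf_le_left)
  · exact (T.op_le_left _ _).trans (h m (hn.trans hm))

end

theorem isYonedaComplete_unit : (unit.{u} T).IsYonedaComplete := fun _ _ _ _ _ _ =>
  ⟨PUnit.unit, isYonedaLimit_const _⟩

theorem IsYonedaComplete.prod (hX : X.IsYonedaComplete) (hY : Y.IsYonedaComplete) :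
    (X.prod Y).IsYonedaComplete := by
  intro D _ _ _ x hx
  obtain ⟨a, ha⟩ := hX D _ (isFunctor_fst.isForwardCauchy hx)
  obtain ⟨b, hb⟩ := hY D _ (isFunctor_snd.isForwardCauchy hx)
  exact ⟨(a, b), isYonedaLimit_prod ha hb⟩

end RealCat

/-! ### Function spaces -/

namespace YCCat

variable {T : ContinuousTNorm}

theorem Hom.isYonedaLimit {X Y : YCCat.{u} T} (f : Hom X Y) {D : Type u} [Preorder D]
    [IsDirectedOrder D] [Nonempty D] {x : D → X.carrier} {a : X.carrier}
    (hx : X.IsForwardCauchy x) (ha : X.IsYonedaLimit x a) :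
    Y.IsYonedaLimit (fun l => f.toFun (x l)) (f.toFun a) :=
  f.isYonedaContinuous D x a hx ha

/-- The degree to which `f` lies below `g`, for Yoneda continuous functors `f` and `g`. -/
noncomputable def Hom.degree {X Y : YCCat.{u} T} (f g : Hom X Y) : unitInterval :=
  ⨅ x, ⨅ x', X.r x x' ⇨ Y.r (f.toFun x) (g.toFun x')

theorem Hom.le_degree_iff {X Y : YCCat.{u} T} {f g : Hom X Y} {c : unitInterval} :
    c ≤ f.degree g ↔ ∀ x x', c ⊓ X.r x x' ≤ Y.r (f.toFun x) (g.toFun x') := by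
  simp only [Hom.degree, le_iInf_iff, le_himp_iff]

theorem Hom.degree_inf_le {X Y : YCCat.{u} T} (f g : Hom X Y) (x x' : X.carrier) :
    f.degree g ⊓ X.r x x' ≤ Y.r (f.toFun x) (g.toFun x') :=
  Hom.le_degree_iff.1 le_rfl x x'

theorem Hom.degree_le {X Y : YCCat.{u} T} (f g : Hom X Y) (x : X.carrier) :
    f.degree g ≤ Y.r (f.toFun x) (g.toFun x) := by
  refine le_trans (le_inf le_rfl ?_) (f.degree_inf_le g x x)
  rw [X.r_self]
  exact unitInterval.le_one'

theorem Hom.degree_mem (K : T.CompleteSubquantale) {X Y : YCCat.{u} T}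
    (hY : isKCategory K Y) (f g : Hom X Y) : f.degree g ∈ K.carrier :=
  K.iInf_mem fun _ => K.iInf_mem fun _ => K.himp_mem _ (hY _ _)

section

variable {X Y : YCCat.{u} T} (hY : isKCategory T.M Y)

/-- The `[0,1]`-category of Yoneda continuous functors into an `M`-category. -/
noncomputable def functionSpace : RealCat.{u} T where
  carrier := Hom X Y
  r f g := f.degree g
  r_self f := le_antisymm unitInterval.le_one'
    (Hom.le_degree_iff.2 fun x x' => inf_le_right.trans (f.isFunctor x x'))
  r_comp f g h := by
    refine Hom.le_degree_iff.2 fun x x' => ?_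
    have hM : ∀ f g : Hom X Y, T.IsIdem (T.op (f.degree g) (f.degree g)) :=
      fun f g => Hom.degree_mem T.M hY f g
    rw [inf_comm]
    -- The two terms are the two routes from `f x` to `h x'`, through `g x'` and through `g x`.
    refine (T.inf_op_le (X.r x x') (hM g h) (hM f g)).trans (sup_le ?_ ?_)
    · rw [T.comm, inf_comm]
      exact RealCat.op_r_le (f.degree_inf_le g x x') (g.degree_le h x')
    · rw [T.comm, inf_comm]
      exact RealCat.op_r_le (f.degree_le g x) (g.degree_inf_le h x x')

variable {D : Type u} [Preorder D] {F : D → Hom X Y}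

/-- A forward Cauchy net of functors approaches its pointwise limit uniformly. -/
theorem exists_forall_inf_le [IsDirectedOrder D] (hF : (functionSpace hY).IsForwardCauchy F)
    {f : X.carrier → Y.carrier} (hf : ∀ x, Y.IsYonedaLimit (fun l => (F l).toFun x) (f x))
    {q : unitInterval} (hq : q < 1) :
    ∃ l, ∀ m, l ≤ m → ∀ x x', q ⊓ X.r x x' ≤ Y.r ((F m).toFun x) (f x') := by
  obtain ⟨l, hl⟩ := RealCat.isForwardCauchy_iff.1 hF q hq
  refine ⟨l, fun m hm x x' => T.le_of_forall_op_le fun p hp => ?_⟩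
  obtain ⟨k, hk⟩ := (RealCat.isYonedaLimit_iff.1 (hf x')).1 p hp
  obtain ⟨n, hkn, hmn⟩ := exists_ge_ge k m
  exact RealCat.op_r_le (Hom.le_degree_iff.1 (hl m n hm hmn) x x') (hk n hkn)

theorem isFunctor_of_pointwise {f : X.carrier → Y.carrier}
    (hf : ∀ x, Y.IsYonedaLimit (fun l => (F l).toFun x) (f x)) :
    RealCat.IsFunctor (X := X.toRealCat) (Y := Y.toRealCat) f := by
  refine fun x x' => T.le_of_forall_op_le fun q hq => ?_
  obtain ⟨l, hl⟩ := (RealCat.isYonedaLimit_iff.1 (hf x')).1 q hq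
  exact (RealCat.isYonedaLimit_iff.1 (hf x)).2 _ _ l fun m hm =>
    RealCat.op_r_le ((F m).isFunctor x x') (hl m hm)

/-- An interchange of limits: by uniformity, `f` can be replaced by a late `F m` at cost `q` at all
points `x i` at once, and `F m` is continuous. -/
theorem isYonedaContinuous_of_pointwise [IsDirectedOrder D]
    (hF : (functionSpace hY).IsForwardCauchy F)
    {f : X.carrier → Y.carrier} (hf : ∀ x, Y.IsYonedaLimit (fun l => (F l).toFun x) (f x)) :
    RealCat.IsYonedaContinuous (X := X.toRealCat) (Y := Y.toRealCat) f := by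
  refine (isFunctor_of_pointwise hf).isYonedaContinuous fun E _ _ _ x a hx ha y c l h => ?_
  refine T.le_of_forall_op_le fun q hq => ?_
  obtain ⟨k, hk⟩ := exists_forall_inf_le hY hF hf hq
  refine (RealCat.isYonedaLimit_iff.1 (hf a)).2 _ _ k fun m hm => ?_
  refine (RealCat.isYonedaLimit_iff.1 ((F m).isYonedaLimit hx ha)).2 _ _ l fun i hi => ?_
  rw [T.comm]
  refine RealCat.op_r_le ((le_inf le_rfl ?_).trans (hk m hm (x i) (x i))) (h i hi)
  rw [X.r_self]
  exact unitInterval.le_one'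

theorem isYonedaLimit_of_pointwise [IsDirectedOrder D]
    (hF : (functionSpace hY).IsForwardCauchy F) {f : Hom X Y}
    (hf : ∀ x, Y.IsYonedaLimit (fun l => (F l).toFun x) (f.toFun x)) :
    (functionSpace hY).IsYonedaLimit F f := by
  refine RealCat.isYonedaLimit_iff.2 ⟨fun q hq => ?_, fun g c l h => ?_⟩
  · obtain ⟨l, hl⟩ := exists_forall_inf_le hY hF hf hq
    exact ⟨l, fun m hm => Hom.le_degree_iff.2 (hl m hm)⟩
  · exact Hom.le_degree_iff.2 fun x x' => (RealCat.isYonedaLimit_iff.1 (hf x)).2 _ _ l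
      fun m hm => Hom.le_degree_iff.1 (h m hm) x x'

theorem exists_pointwise_limit [IsDirectedOrder D] [Nonempty D]
    (hF : (functionSpace hY).IsForwardCauchy F) :
    ∃ f : Hom X Y, ∀ x, Y.IsYonedaLimit (fun l => (F l).toFun x) (f.toFun x) := by
  have hF' : ∀ x, Y.IsForwardCauchy fun l => (F l).toFun x := fun x =>
    RealCat.IsFunctor.isForwardCauchy (X := functionSpace hY) (f := fun f : Hom X Y => f.toFun x)
      (fun f g => Hom.degree_le f g x) hF
  choose f hf using fun x => Y.complete D _ (hF' x)
  exact ⟨⟨f, isFunctor_of_pointwise hf, isYonedaContinuous_of_pointwise hY hF hf⟩, hf⟩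

/-- Any limit in the function space is isomorphic to the pointwise one, hence is itself pointwise.
Continuity of evaluation needs this. -/
theorem pointwise_isYonedaLimit [IsDirectedOrder D] [Nonempty D]
    (hF : (functionSpace hY).IsForwardCauchy F) {f : Hom X Y}
    (hf : (functionSpace hY).IsYonedaLimit F f) (x : X.carrier) :
    Y.IsYonedaLimit (fun l => (F l).toFun x) (f.toFun x) := by
  obtain ⟨g, hg⟩ := exists_pointwise_limit hY hF
  have hg' := isYonedaLimit_of_pointwise hY hF hg
  have key : ∀ {f g : Hom X Y}, f.degree g = 1 → Y.r (f.toFun x) (g.toFun x) = 1 :=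
    fun {f g} h => le_antisymm unitInterval.le_one' (h.symm.le.trans (f.degree_le g x))
  exact (hg x).of_r_eq_one (key (hg'.r_eq_one hf)) (key (hf.r_eq_one hg'))

end

/-! ### Products, evaluation and currying in `YCCat` -/

/-- The terminal object. -/
def unit (T : ContinuousTNorm) : YCCat.{u} T := ⟨RealCat.unit T, RealCat.isYonedaComplete_unit⟩

/-- The map to the terminal object. -/
def toUnit (X : YCCat.{u} T) : X ⟶ unit T where
  toFun _ := PUnit.unit
  isFunctor _ _ := unitInterval.le_one'
  isYonedaContinuous _ _ _ _ _ _ _ _ := RealCat.isYonedaLimit_const _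

theorem unit_hom_ext {X : YCCat.{u} T} (f g : X ⟶ unit T) : f = g :=
  Hom.ext (funext fun _ => rfl)

/-- The product of Yoneda complete `[0,1]`-categories. -/
def prod (X Y : YCCat.{u} T) : YCCat.{u} T :=
  ⟨X.toRealCat.prod Y.toRealCat, X.complete.prod Y.complete⟩

section

variable {X Y Z : YCCat.{u} T}

/-- The first projection. -/
def fst : X.prod Y ⟶ X where
  toFun p := p.1
  isFunctor := RealCat.isFunctor_fst
  isYonedaContinuous := RealCat.isYonedaContinuous_fst

/-- The second projection. -/
def snd : X.prod Y ⟶ Y where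
  toFun p := p.2
  isFunctor := RealCat.isFunctor_snd
  isYonedaContinuous := RealCat.isYonedaContinuous_snd

/-- The morphism into a product with given components. -/
def lift (f : Z ⟶ X) (g : Z ⟶ Y) : Z ⟶ X.prod Y where
  toFun z := (f.toFun z, g.toFun z)
  isFunctor _ _ := le_inf (f.isFunctor _ _) (g.isFunctor _ _)
  isYonedaContinuous _ _ _ _ _ _ hx ha :=
    RealCat.isYonedaLimit_prod (f.isYonedaLimit hx ha) (g.isYonedaLimit hx ha)

theorem lift_fst (f : Z ⟶ X) (g : Z ⟶ Y) : lift f g ≫ fst = f := rfl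

theorem lift_snd (f : Z ⟶ X) (g : Z ⟶ Y) : lift f g ≫ snd = g := rfl

theorem prod_hom_ext {f g : Z ⟶ X.prod Y} (h₁ : f ≫ fst = g ≫ fst) (h₂ : f ≫ snd = g ≫ snd) :
    f = g :=
  Hom.ext (funext fun z =>
    Prod.ext (congrFun (congrArg Hom.toFun h₁) z) (congrFun (congrArg Hom.toFun h₂) z))

variable (hY : isKCategory T.M Y)

/-- The exponential of Yoneda complete `M`-categories. -/
noncomputable def exp (X : YCCat.{u} T) (hY : isKCategory T.M Y) : YCCat.{u} T where
  toRealCat := functionSpace (X := X) hY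
  complete _ _ _ _ _ hF :=
    have ⟨f, hf⟩ := exists_pointwise_limit hY hF
    ⟨f, isYonedaLimit_of_pointwise hY hF hf⟩

/-- Evaluation. -/
def ev : X.prod (exp X hY) ⟶ Y where
  toFun p := Hom.toFun p.2 p.1
  isFunctor p p' := inf_comm _ _ |>.le.trans (Hom.degree_inf_le p.2 p'.2 p.1 p'.1)
  isYonedaContinuous := by
    refine RealCat.IsFunctor.isYonedaContinuous
      (fun p p' => inf_comm _ _ |>.le.trans (Hom.degree_inf_le p.2 p'.2 p.1 p'.1))
      fun D _ _ _ p a hp ha y c l h => ?_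
    have hx := RealCat.isFunctor_fst.isForwardCauchy hp
    have hF := RealCat.isFunctor_snd.isForwardCauchy hp
    have hax := RealCat.isYonedaContinuous_fst D p a hp ha
    have haF := RealCat.isYonedaContinuous_snd D p a hp ha
    refine T.le_of_forall_op_le fun q hq => ?_
    obtain ⟨k, hk⟩ := RealCat.isForwardCauchy_iff.1 hp q hq
    obtain ⟨n, hln, hkn⟩ := exists_ge_ge l k
    -- The limit is split into one over functors (`j`) and one over points (`i`). The Cauchy
    -- condition then compares the pair `(i, j)` with a diagonal index `m` above both, where `h`
    -- applies.
    refine (RealCat.isYonedaLimit_iff.1 (pointwise_isYonedaLimit hY hF haF a.1)).2 _ _ n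
      fun j hj => ?_
    refine (RealCat.isYonedaLimit_iff.1 (Hom.isYonedaLimit (p j).2 hx hax)).2 _ _ n
      fun i hi => ?_
    obtain ⟨m, him, hjm⟩ := exists_ge_ge i j
    rw [T.comm]
    refine RealCat.op_r_le (le_trans (le_inf ?_ ?_)
      (Hom.degree_inf_le (p j).2 (p m).2 (p i).1 (p m).1)) (h m (hln.trans (hi.trans him)))
    · exact (hk j m (hkn.trans hj) hjm).trans inf_le_right
    · exact (hk i m (hkn.trans hi) him).trans inf_le_left

/-- A morphism on a product with its second argument fixed. -/
def partialApply (f : X.prod Z ⟶ Y) (z : Z.carrier) : X ⟶ Y where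
  toFun x := f.toFun (x, z)
  isFunctor x x' := (le_inf le_rfl ((Z.r_self z).symm ▸ unitInterval.le_one')).trans
    (f.isFunctor (x, z) (x', z))
  isYonedaContinuous D _ _ _ x a hx ha :=
    Hom.isYonedaLimit (X := X.prod Z) f (x := fun l : D => (x l, z)) (a := (a, z))
      (RealCat.isForwardCauchy_prod hx (RealCat.isForwardCauchy_const z))
      (RealCat.isYonedaLimit_prod ha (RealCat.isYonedaLimit_const z))

theorem r_le_degree_partialApply (f : X.prod Z ⟶ Y) (z z' : Z.carrier) :
    Z.r z z' ≤ Hom.degree (partialApply f z) (partialApply f z') :=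
  Hom.le_degree_iff.2 fun x x' => (inf_comm _ _).le.trans (f.isFunctor (x, z) (x', z'))

/-- The transpose of a morphism on a product. -/
noncomputable def curry (f : X.prod Z ⟶ Y) : Z ⟶ exp X hY where
  toFun := partialApply f
  isFunctor := r_le_degree_partialApply f
  isYonedaContinuous D _ _ _ z a hz ha :=
    isYonedaLimit_of_pointwise hY (F := fun l => partialApply f (z l)) (f := partialApply f a)
      (RealCat.IsFunctor.isForwardCauchy (X := Z.toRealCat) (Y := functionSpace hY)
        (f := partialApply f) (r_le_degree_partialApply f) hz)
      fun x => Hom.isYonedaLimit (X := X.prod Z) f (x := fun l : D => (x, z l)) (a := (x, a))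
        (RealCat.isForwardCauchy_prod (RealCat.isForwardCauchy_const x) hz)
        (RealCat.isYonedaLimit_prod (RealCat.isYonedaLimit_const x) ha)

/-- The exponential law. -/
noncomputable def curryEquiv : (X.prod Z ⟶ Y) ≃ (Z ⟶ exp X hY) where
  toFun := curry hY
  invFun g := lift fst (snd ≫ g) ≫ ev hY
  left_inv _ := rfl
  right_inv _ := rfl

theorem curryEquiv_naturality {W : YCCat.{u} T} (f : W ⟶ Z) (g : X.prod Z ⟶ Y) :
    curryEquiv hY (lift fst (snd ≫ f) ≫ g) = f ≫ curryEquiv hY g := rfl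

end

/-! ### Stability of `K`-categories and of symmetry -/

theorem isKCategory_unit (K : T.CompleteSubquantale) : isKCategory K (unit.{u} T) :=
  fun _ _ => K.one_mem

theorem isKCategory_prod {K : T.CompleteSubquantale} {X Y : YCCat.{u} T} (hX : isKCategory K X)
    (hY : isKCategory K Y) : isKCategory K (X.prod Y) :=
  fun _ _ => K.inf_mem (hX _ _) (hY _ _)

theorem isKCategory_exp {K : T.CompleteSubquantale} (X : YCCat.{u} T) {Y : YCCat.{u} T}
    (hY : isKCategory K Y) (hM : isKCategory T.M Y) : isKCategory K (exp X hM) :=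
  fun f g => Hom.degree_mem K hY f g

theorem isSymmetric_prod {X Y : YCCat.{u} T} (hX : X.IsSymmetric) (hY : Y.IsSymmetric) :
    (X.prod Y).IsSymmetric :=
  fun _ _ => congrArg₂ (· ⊓ ·) (hX _ _) (hY _ _)

/-- Interchanging `x` and `x'` in the defining meet turns `f.degree g` into `g.degree f`; this uses
symmetry of both `X` and `Y`. -/
theorem isSymmetric_exp {X Y : YCCat.{u} T} (hX : X.IsSymmetric) (hY : Y.IsSymmetric)
    (hM : isKCategory T.M Y) : (exp X hM).IsSymmetric := by
  have key : ∀ f g : Hom X Y, f.degree g ≤ g.degree f := fun f g =>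
    Hom.le_degree_iff.2 fun x x' => by
      rw [hX x x', hY (g.toFun x)]
      exact f.degree_inf_le g x' x
  exact fun f g => le_antisymm (key f g) (key g f)

/-! ### Transport along a fully faithful functor -/

open Limits MonoidalCategory in
/-- A category with a fully faithful functor to `YCCat` whose values are `M`-categories is
cartesian closed if its objects are stable under finite products and exponentials. -/
theorem isCartesianClosed_of_fullyFaithful {C : Type (u + 1)} [Category.{u} C]
    {F : C ⥤ YCCat.{u} T} (hF : F.FullyFaithful) (hM : ∀ X, isKCategory T.M (F.obj X))
    (one : C) (e₁ : F.obj one ≅ unit T)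
    (pr : C → C → C) (e₂ : ∀ X Y, F.obj (pr X Y) ≅ (F.obj X).prod (F.obj Y))
    (ex : C → C → C) (e₃ : ∀ X Y, F.obj (ex X Y) ≅ exp (F.obj X) (hM Y)) :
    IsCartesianClosed C := by
  let p (X Y : C) : pr X Y ⟶ X := hF.preimage ((e₂ X Y).hom ≫ fst)
  let q (X Y : C) : pr X Y ⟶ Y := hF.preimage ((e₂ X Y).hom ≫ snd)
  let l {X Y Z : C} (f : Z ⟶ X) (g : Z ⟶ Y) : Z ⟶ pr X Y :=
    hF.preimage (lift (F.map f) (F.map g) ≫ (e₂ X Y).inv)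
  have ext {X Y Z : C} {f g : Z ⟶ pr X Y} (h₁ : f ≫ p X Y = g ≫ p X Y)
      (h₂ : f ≫ q X Y = g ≫ q X Y) : f = g := by
    refine hF.map_injective ((cancel_mono (e₂ X Y).hom).1 (prod_hom_ext ?_ ?_))
    · simpa [p] using congrArg F.map h₁
    · simpa [q] using congrArg F.map h₂
  have lp {X Y Z : C} (f : Z ⟶ X) (g : Z ⟶ Y) : l f g ≫ p X Y = f :=
    hF.map_injective (by simp [l, p, lift_fst])
  have lq {X Y Z : C} (f : Z ⟶ X) (g : Z ⟶ Y) : l f g ≫ q X Y = g :=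
    hF.map_injective (by simp [l, q, lift_snd])
  let hone : IsTerminal one := IsTerminal.ofUniqueHom
    (fun X => hF.preimage (toUnit _ ≫ e₁.inv))
    fun X f => hF.map_injective ((cancel_mono e₁.hom).1 (unit_hom_ext _ _))
  let B (X Y : C) : LimitCone (pair X Y) :=
    { cone := BinaryFan.mk (p X Y) (q X Y)
      isLimit := BinaryFan.isLimitMk (fun s => l s.fst s.snd) (fun s => lp _ _)
        (fun s => lq _ _) fun s m h₁ h₂ => ext (h₁.trans (lp _ _).symm) (h₂.trans (lq _ _).symm) }
  let I : CartesianMonoidalCategory C := .ofChosenFiniteProducts ⟨_, hone⟩ B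
  refine ⟨I, ⟨⟨fun X => ?_⟩⟩⟩
  let e (Z Y : C) : (pr X Z ⟶ Y) ≃ (Z ⟶ ex X Y) :=
    hF.homEquiv.trans (((e₂ X Z).homCongr (Iso.refl _)).trans ((curryEquiv (hM Y)).trans
      (((Iso.refl _).homCongr (e₃ X Y).symm).trans hF.homEquiv.symm)))
  have he (Z W Y : C) (f : Z ⟶ W) (g : pr X W ⟶ Y) :
      e Z Y (l (p X Z) (q X Z ≫ f) ≫ g) = f ≫ e W Y g := by
    refine hF.map_injective ?_
    have h : lift (fst (X := F.obj X)) (snd ≫ F.map f) =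
      (e₂ X Z).inv ≫ lift (F.map (p X Z)) (F.map (q X Z ≫ f)) := prod_hom_ext
        (by simp [p, lift_fst]) (by simp [q, lift_snd])
    have := curryEquiv_naturality (hM Y) (F.map f) ((e₂ X W).inv ≫ F.map g)
    rw [h] at this
    simpa [e, l, Functor.FullyFaithful.homEquiv, Iso.homCongr] using
      congrArg (· ≫ (e₃ X Y).inv) this
  have hw (Z W Y : C) (f : Z ⟶ W) (g : pr X W ⟶ Y) :
      e Z Y ((tensorLeft X).map f ≫ g) = f ≫ e W Y g := by
    -- Whiskering and `l` agree because both have the same two projections.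
    have h : (tensorLeft X).map f = l (p X Z) (q X Z ≫ f) :=
      ext ((CartesianMonoidalCategory.whiskerLeft_fst X f).trans (lp _ _).symm)
        ((CartesianMonoidalCategory.whiskerLeft_snd X f).trans (lq _ _).symm)
    exact (congrArg (fun k => e Z Y (k ≫ g)) h).trans (he Z W Y f g)
  exact ⟨_, Adjunction.adjunctionOfEquivRight (F := tensorLeft X) e hw⟩

end YCCat

theorem mainTheorem6 (T : ContinuousTNorm) (K : T.CompleteSubquantale)
    (hK : K.carrier ⊆ T.M.carrier) :
    IsCartesianClosed (KYCCat.{u} K) ∧ IsCartesianClosed (SymKYCCat.{u} K) := by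
  constructor
  · exact YCCat.isCartesianClosed_of_fullyFaithful (YCCat.isKCategory K).fullyFaithfulι
      (fun X x y => hK (X.property x y))
      ⟨_, YCCat.isKCategory_unit K⟩ (Iso.refl _)
      (fun X Y => ⟨_, YCCat.isKCategory_prod X.property Y.property⟩) (fun _ _ => Iso.refl _)
      (fun X Y => ⟨_, YCCat.isKCategory_exp X.obj Y.property fun x y => hK (Y.property x y)⟩)
      (fun _ _ => Iso.refl _)
  · exact YCCat.isCartesianClosed_of_fullyFaithful
      ((KYCCat.isSymmetric K).fullyFaithfulι.comp (YCCat.isKCategory K).fullyFaithfulι)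
      (fun X x y => hK (X.obj.property x y))
      ⟨⟨_, YCCat.isKCategory_unit K⟩, fun _ _ => rfl⟩ (Iso.refl _)
      (fun X Y => ⟨⟨_, YCCat.isKCategory_prod X.obj.property Y.obj.property⟩,
        YCCat.isSymmetric_prod X.property Y.property⟩) (fun _ _ => Iso.refl _)
      (fun X Y => ⟨⟨_, YCCat.isKCategory_exp X.obj.obj Y.obj.property
        fun x y => hK (Y.obj.property x y)⟩, YCCat.isSymmetric_exp X.property Y.property _⟩)
      (fun _ _ => Iso.refl _)
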